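/- For integers $n, m \ge 0$ let $cp_{1-1}(n,m)$ be the number of partitions of $n$ into exactly $m$ (positive) parts such that any two successive parts $\lambda_i \le \lambda_{i+1}$ satisfy $\lambda_{i+1}-\lambda_i \ge 2$, and moreover $\lambda_{i+1}-\lambda_i \ge 4$ unless $\lambda_i+\lambda_{i+1} \equiv 1 \pmod 3$ (so $cp_{1-1}(0,0)=1$, counting the empty partition). Write $(a;q)_n = \prod_{j=1}^{n} (1 - a q^{j-1})$, with $(a;q)_0=1$. Then, as an identity of formal power series in $q$ and $x$ (both sums converging coefficientwise), \[ \sum_{m,n \ge 0} cp_{1-1}(n,m)\, q^n x^m \;=\; \sum_{n_1,n_2 \ge 0} \frac{q^{6n_2^2-2n_2+2n_1^2-n_1+6n_1n_2}\; x^{2n_2+n_1}}{(q;q)_{n_1}\,(q^3;q^3)_{n_2}} . \] -/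

import Mathlib

open scoped MvPowerSeries.WithPiTopology

/-- The formal variable `q` in `ℤ⟦q, x⟧`. -/
noncomputable def qVar : MvPowerSeries (Fin 2) ℤ := MvPowerSeries.X 0

/-- The formal variable `x` in `ℤ⟦q, x⟧`. -/
noncomputable def xVar : MvPowerSeries (Fin 2) ℤ := MvPowerSeries.X 1

/-- The `q`-Pochhammer symbol `(a; q)_n = ∏_{j = 1}^{n} (1 - a q^{j-1})`. -/
def qPoch {R : Type*} [CommRing R] (a q : R) (n : ℕ) : R :=
  ∏ j ∈ Finset.range n, (1 - a * q ^ j)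

/-- Two successive parts `a ≤ b` are admissible if they differ by at least two, and by at least
four unless `a + b ≡ 1 (mod 3)`. -/
def AdmissiblePair (a b : ℕ) : Prop :=
  a + 2 ≤ b ∧ (a + 4 ≤ b ∨ a + b ≡ 1 [MOD 3])

/-- All pairs of successive parts of the partition, listed in increasing order, are admissible. -/
def IsAdmissible {n : ℕ} (p : n.Partition) : Prop :=
  (p.parts.sort (· ≤ ·)).IsChain AdmissiblePair

/-- The number `cp_{1-1}(n, m)` of admissible partitions of `n` into `m` parts. -/
noncomputable def cpOneOne (n m : ℕ) : ℕ :=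
  {p : n.Partition | Multiset.card p.parts = m ∧ IsAdmissible p}.ncard

/-- The exponent `6 n₂² - 2 n₂ + 2 n₁² - n₁ + 6 n₁ n₂`; the subtraction never truncates, see
`qExponent_cast`. -/
def qExponent (n₁ n₂ : ℕ) : ℕ :=
  6 * n₂ ^ 2 + 2 * n₁ ^ 2 + 6 * n₁ * n₂ - (2 * n₂ + n₁)

theorem qExponent_cast (n₁ n₂ : ℕ) :
    (qExponent n₁ n₂ : ℤ) =
      6 * (n₂ : ℤ) ^ 2 - 2 * n₂ + 2 * (n₁ : ℤ) ^ 2 - n₁ + 6 * n₁ * n₂ := by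
  have h : 2 * n₂ + n₁ ≤ 6 * n₂ ^ 2 + 2 * n₁ ^ 2 + 6 * n₁ * n₂ := by
    have h1 : n₁ ≤ n₁ ^ 2 := Nat.le_self_pow two_ne_zero n₁
    have h2 : n₂ ≤ n₂ ^ 2 := Nat.le_self_pow two_ne_zero n₂
    have h3 : 0 ≤ 6 * n₁ * n₂ := Nat.zero_le _
    omega
  unfold qExponent
  rw [Nat.cast_sub h]
  push_cast
  ring

/-- The denominator `(q; q)_{n₁} (q³; q³)_{n₂}`. -/
noncomputable def qDenom (n₁ n₂ : ℕ) : MvPowerSeries (Fin 2) ℤ :=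
  qPoch qVar qVar n₁ * qPoch (qVar ^ 3) (qVar ^ 3) n₂

/-- The reciprocal of `(q; q)_{n₁} (q³; q³)_{n₂}` in `ℤ⟦q, x⟧`. -/
noncomputable def qDenomInv (n₁ n₂ : ℕ) : MvPowerSeries (Fin 2) ℤ :=
  MvPowerSeries.invOfUnit (qDenom n₁ n₂) 1

theorem qDenom_mul_qDenomInv (n₁ n₂ : ℕ) : qDenom n₁ n₂ * qDenomInv n₁ n₂ = 1 := by
  apply MvPowerSeries.mul_invOfUnit
  simp [qDenom, qPoch, qVar, map_prod]

/-! Let F, H, K be the `q`-series counting admissible partitions into `m` parts with smallest part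
at least 1, 2, 3. Admissibility is invariant under adding 3 to every part
(`admissiblePair_add_three`), so raising the lower bound by 3 multiplies the series by `qVar ^ (3 *
m)`. Splitting off a smallest part 1, 2 or 3 then closes up into the recurrences `CapparelliSystem`,
which determine F (`CapparelliSystem.unique`).

On the other side, `doubleSum a b m` adds `a * n₁ + b * n₂` to the exponent in the coefficient of `x
^ m`. Cancelling the last factor of either Pochhammer symbol gives contiguous relations
(`doubleSum_succ_left`, `doubleSum_succ_right`), and from these the shifts (0,0), (1,3), (2,6)
satisfy the same system. Hence the coefficients of each `x ^ m` agree. -/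

/-! ### Admissible chains with a condition on the smallest part -/

/-- The increasing lists of `m` parts with sum `n`, all successive parts admissible, whose smallest
part, if there is one, satisfies `P`. -/
def admissibleChains (P : ℕ → Prop) (m n : ℕ) : Set (List ℕ) :=
  {l | l.IsChain AdmissiblePair ∧ (∀ h ∈ l.head?, P h) ∧ l.length = m ∧ l.sum = n}

theorem admissibleChains_zero_zero (P : ℕ → Prop) : admissibleChains P 0 0 = {[]} := by
  ext l
  simp only [admissibleChains, Set.mem_ofPred_eq, Set.mem_singleton_iff, List.length_eq_zero_iff]
  constructor
  · exact fun h => h.2.2.1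
  · rintro rfl
    simp

theorem admissibleChains_zero_succ (P : ℕ → Prop) (n : ℕ) :
    admissibleChains P 0 (n + 1) = ∅ := by
  ext l
  simp only [admissibleChains, Set.mem_ofPred_eq, List.length_eq_zero_iff,
    Set.mem_empty_iff_false, iff_false]
  rintro ⟨-, -, rfl, h⟩
  simp at h

/-- Needed because `Set.ncard` is 0 on infinite sets. Zero parts are allowed here; the fixed length
keeps the set finite. -/
theorem finite_admissibleChains (P : ℕ → Prop) (m n : ℕ) : (admissibleChains P m n).Finite := by
  have : ∀ m n : ℕ, {l : List ℕ | l.length = m ∧ l.sum = n}.Finite := by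
    intro m
    induction m with
    | zero =>
      intro n
      refine (Set.finite_singleton []).subset ?_
      rintro l ⟨hl, -⟩
      exact List.length_eq_zero_iff.1 hl
    | succ m ih =>
      intro n
      refine ((Set.finite_Iic n).biUnion fun h _ => (ih (n - h)).image (List.cons h)).subset ?_
      rintro (_ | ⟨h, l⟩) ⟨hl, hs⟩
      · simp at hl
      · simp only [List.length_cons, List.sum_cons] at hl hs
        simp only [Set.mem_iUnion]
        exact ⟨h, by simp; omega, l, ⟨by omega, by omega⟩, rfl⟩
  exact (this m n).subset fun l hl => hl.2.2

/-- The length is `m + 1` because the empty list meets both head conditions vacuously. -/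
theorem ncard_admissibleChains_or {P Q : ℕ → Prop} (hPQ : ∀ h, P h → ¬ Q h) (m n : ℕ) :
    (admissibleChains (fun h => P h ∨ Q h) (m + 1) n).ncard =
      (admissibleChains P (m + 1) n).ncard + (admissibleChains Q (m + 1) n).ncard := by
  rw [← Set.ncard_union_eq _ (finite_admissibleChains ..) (finite_admissibleChains ..)]
  · congr 1
    ext (_ | ⟨h, l⟩) <;> simp [admissibleChains]
    tauto
  · rw [Set.disjoint_left]
    rintro (_ | ⟨h, l⟩) <;> simp [admissibleChains]
    intro _ hP _ _ _ hQ
    exact absurd hQ (hPQ h hP)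

theorem ncard_admissibleChains_eq (j m n : ℕ) :
    (admissibleChains (fun h => h = j) (m + 1) n).ncard =
      if j ≤ n then (admissibleChains (AdmissiblePair j) m (n - j)).ncard else 0 := by
  split_ifs with hj
  · rw [← Set.ncard_image_of_injective (admissibleChains (AdmissiblePair j) m (n - j))
      (List.cons_injective (a := j))]
    congr 1
    ext (_ | ⟨h, l⟩)
    · simp [admissibleChains]
    · simp only [admissibleChains, Set.mem_ofPred_eq, Set.mem_image, List.cons.injEq,
        List.isChain_cons, List.length_cons, List.sum_cons, List.head?_cons, Option.mem_def,
        Option.some.injEq, forall_eq']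
      constructor
      · rintro ⟨⟨h1, h2⟩, rfl, h3, h4⟩
        exact ⟨l, ⟨h2, h1, by omega, by omega⟩, rfl, rfl⟩
      · rintro ⟨_, ⟨h2, h1, h3, h4⟩, rfl, rfl⟩
        exact ⟨⟨h1, h2⟩, rfl, by omega, by omega⟩
  · rw [Set.ncard_eq_zero (finite_admissibleChains ..), Set.eq_empty_iff_forall_notMem]
    rintro (_ | ⟨h, l⟩)
    · simp [admissibleChains]
    · simp only [admissibleChains, Set.mem_ofPred_eq, List.sum_cons, List.head?_cons,
        Option.mem_def, Option.some.injEq, forall_eq']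
      rintro ⟨-, rfl, -, h4⟩
      omega

theorem AdmissiblePair.lt {a b : ℕ} (h : AdmissiblePair a b) : a < b := by
  have := h.1
  omega

/-- Differences are unchanged and the sum grows by 6, a multiple of 3. -/
theorem admissiblePair_add_three {a b : ℕ} :
    AdmissiblePair (a + 3) (b + 3) ↔ AdmissiblePair a b := by
  simp only [AdmissiblePair, Nat.ModEq]
  omega

theorem pairwise_lt_of_isChain_admissiblePair {l : List ℕ} (h : l.IsChain AdmissiblePair) :
    l.Pairwise (· < ·) :=
  List.isChain_iff_pairwise.1 (h.imp fun _ _ => AdmissiblePair.lt)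

theorem le_of_mem_of_le_head {j : ℕ} {l : List ℕ} (h : l.IsChain AdmissiblePair)
    (hj : ∀ h ∈ l.head?, j ≤ h) : ∀ a ∈ l, j ≤ a := by
  have hl := pairwise_lt_of_isChain_admissiblePair h
  cases l with
  | nil => simp
  | cons b l =>
    simp only [List.head?_cons, Option.mem_def, Option.some.injEq, forall_eq'] at hj
    intro a ha
    rcases List.mem_cons.1 ha with rfl | ha
    · exact hj
    · exact hj.trans (List.rel_of_pairwise_cons hl ha).le

theorem sum_map_add_const (l : List ℕ) (k : ℕ) :
    (l.map (· + k)).sum = l.sum + k * l.length := by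
  induction l with
  | nil => simp
  | cons a l ih =>
    simp only [List.map_cons, List.sum_cons, List.length_cons, ih]
    ring

theorem ncard_admissibleChains_add_three_le (j m n : ℕ) :
    (admissibleChains (fun h => j + 3 ≤ h) m n).ncard =
      if 3 * m ≤ n then (admissibleChains (fun h => j ≤ h) m (n - 3 * m)).ncard else 0 := by
  have key : ∀ l ∈ admissibleChains (fun h => j + 3 ≤ h) m n, ∃ l' : List ℕ,
      l'.map (· + 3) = l ∧ l'.sum + 3 * m = n ∧ l' ∈ admissibleChains (fun h => j ≤ h) m l'.sum := by
    rintro l ⟨h1, h2, h3, h4⟩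
    have hmem := le_of_mem_of_le_head h1 h2
    -- Chains increase, so the bound on the head bounds every part and the subtraction never
    -- truncates.
    have hmap : (l.map (· - 3)).map (· + 3) = l := by
      rw [List.map_map]
      conv_rhs => rw [← List.map_id l]
      refine List.map_congr_left fun a ha => ?_
      have := hmem a ha
      simp only [Function.comp_apply, id]
      omega
    refine ⟨l.map (· - 3), hmap, ?_, ?_, ?_, by simpa using h3, rfl⟩
    · rw [← h4, ← h3]
      conv_rhs => rw [← hmap, sum_map_add_const]
      simp
    · rw [← hmap, List.isChain_map] at h1
      simpa only [admissiblePair_add_three] using h1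
    · cases l with
      | nil => simp
      | cons a l =>
        simp only [List.head?_cons, Option.mem_def, Option.some.injEq, forall_eq',
          List.map_cons] at h2 ⊢
        omega
  split_ifs with hn
  · rw [← Set.ncard_image_of_injective (admissibleChains (fun h => j ≤ h) m (n - 3 * m))
      (List.map_injective_iff.2 (add_left_injective 3))]
    congr 1
    ext l
    constructor
    · intro hl
      obtain ⟨l', rfl, h2, h3⟩ := key l hl
      have : n - 3 * m = l'.sum := by omega
      exact ⟨l', this ▸ h3, rfl⟩
    · rintro ⟨l', ⟨h1, h2, h3, h4⟩, rfl⟩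
      refine ⟨?_, ?_, by simpa using h3, ?_⟩
      · rw [List.isChain_map]
        simpa only [admissiblePair_add_three] using h1
      · cases l' with
        | nil => simp
        | cons a l' => simpa using h2
      · rw [sum_map_add_const, h3, h4]
        omega
  · rw [Set.ncard_eq_zero (finite_admissibleChains ..), Set.eq_empty_iff_forall_notMem]
    intro l hl
    obtain ⟨l', -, h, -⟩ := key l hl
    omega

theorem cpOneOne_eq_ncard (n m : ℕ) :
    cpOneOne n m = (admissibleChains (fun h => 1 ≤ h) m n).ncard := by
  refine Set.ncard_congr (fun p _ => p.parts.sort (· ≤ ·)) ?_ ?_ ?_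
  · rintro p ⟨hp, hc⟩
    refine ⟨hc, fun h hh => ?_, ?_, ?_⟩
    · exact p.parts_pos ((Multiset.mem_sort (r := (· ≤ ·))).1 (List.mem_of_mem_head? hh))
    · rw [Multiset.length_sort, hp]
    · rw [← Multiset.sum_coe, Multiset.sort_eq, p.parts_sum]
  · intro p p' _ _ h
    ext1
    rw [← Multiset.sort_eq p.parts (· ≤ ·), ← Multiset.sort_eq p'.parts (· ≤ ·), h]
  · rintro l ⟨h1, h2, h3, h4⟩
    have hs : (l : Multiset ℕ).sort (· ≤ ·) = l := by
      rw [Multiset.coe_sort]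
      exact List.mergeSort_of_pairwise
        ((pairwise_lt_of_isChain_admissiblePair h1).imp fun h => by simpa using h.le)
    refine ⟨⟨l, fun hi => le_of_mem_of_le_head h1 h2 _ hi, by simpa using h4⟩, ⟨?_, ?_⟩, ?_⟩
    · simpa using h3
    · rw [IsAdmissible, hs]
      exact h1
    · exact hs

/-! ### Power series in `q` -/

/-- The power series `∑ c(n) qⁿ` as an element of `ℤ⟦q, x⟧`. -/
noncomputable def qSeries (c : ℕ → ℕ) : MvPowerSeries (Fin 2) ℤ :=
  fun d => if d 1 = 0 then (c (d 0) : ℤ) else 0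

theorem coeff_qSeries (c : ℕ → ℕ) (d : Fin 2 →₀ ℕ) :
    MvPowerSeries.coeff d (qSeries c) = if d 1 = 0 then (c (d 0) : ℤ) else 0 := rfl

theorem qSeries_add (c c' : ℕ → ℕ) :
    qSeries (fun n => c n + c' n) = qSeries c + qSeries c' := by
  ext d
  simp only [coeff_qSeries, map_add]
  split_ifs <;> simp

theorem qVar_pow_mul_qSeries (k : ℕ) (c : ℕ → ℕ) :
    qVar ^ k * qSeries c = qSeries fun n => if k ≤ n then c (n - k) else 0 := by
  ext d
  rw [qVar, MvPowerSeries.X_pow_eq, MvPowerSeries.coeff_monomial_mul, coeff_qSeries, coeff_qSeries]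
  have h : Finsupp.single 0 k ≤ d ↔ k ≤ d 0 := Finsupp.single_le_iff
  simp only [h, one_mul, Finsupp.coe_tsub, Pi.sub_apply, Finsupp.single_eq_same]
  have h' : (Finsupp.single (0 : Fin 2) k) 1 = 0 := by simp
  rw [h', Nat.sub_zero]
  split_ifs <;> simp

theorem qSeries_delta (c : ℕ → ℕ) (h0 : c 0 = 1) (h : ∀ n, c (n + 1) = 0) : qSeries c = 1 := by
  ext d
  rw [coeff_qSeries, MvPowerSeries.coeff_one]
  have hd : d = 0 ↔ d 0 = 0 ∧ d 1 = 0 := by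
    rw [Finsupp.ext_iff, Fin.forall_fin_two]
    simp
  rcases hn : d 0 with _ | n <;> simp [hd, hn, h0, h]

theorem coeff_mul_xVar_pow (φ : MvPowerSeries (Fin 2) ℤ) (m : ℕ) (d : Fin 2 →₀ ℕ) :
    MvPowerSeries.coeff d (φ * xVar ^ m) =
      if m ≤ d 1 then MvPowerSeries.coeff (d - Finsupp.single 1 m) φ else 0 := by
  rw [mul_comm, xVar, MvPowerSeries.X_pow_eq, MvPowerSeries.coeff_monomial_mul]
  simp [Finsupp.single_le_iff]

/-- The generating function of `admissibleChains P m`. -/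
noncomputable def chainSeries (P : ℕ → Prop) (m : ℕ) : MvPowerSeries (Fin 2) ℤ :=
  qSeries fun n => (admissibleChains P m n).ncard

theorem chainSeries_zero (P : ℕ → Prop) : chainSeries P 0 = 1 :=
  qSeries_delta _ (by rw [admissibleChains_zero_zero, Set.ncard_singleton])
    fun n => by rw [admissibleChains_zero_succ, Set.ncard_empty]

theorem chainSeries_or {P Q : ℕ → Prop} (hPQ : ∀ h, P h → ¬ Q h) (m : ℕ) :
    chainSeries (fun h => P h ∨ Q h) (m + 1) = chainSeries P (m + 1) + chainSeries Q (m + 1) := by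
  simp only [chainSeries, ncard_admissibleChains_or hPQ, qSeries_add]

theorem chainSeries_eq (j m : ℕ) :
    chainSeries (fun h => h = j) (m + 1) = qVar ^ j * chainSeries (AdmissiblePair j) m := by
  simp only [chainSeries, ncard_admissibleChains_eq, qVar_pow_mul_qSeries]

theorem chainSeries_add_three_le (j m : ℕ) :
    chainSeries (fun h => j + 3 ≤ h) m = qVar ^ (3 * m) * chainSeries (fun h => j ≤ h) m := by
  simp only [chainSeries, ncard_admissibleChains_add_three_le, qVar_pow_mul_qSeries]

theorem chainSeries_le (j m : ℕ) :
    chainSeries (fun h => j ≤ h) (m + 1) =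
      chainSeries (fun h => j + 1 ≤ h) (m + 1) + qVar ^ j * chainSeries (AdmissiblePair j) m := by
  rw [← chainSeries_eq, ← chainSeries_or (fun h h1 h2 => by omega)]
  congr 1
  ext h
  omega

/-- Gaps 2 and 3 are the exceptional ones: the congruence admits 1, 3 and 2, 5, but no such gap
after 3. -/
theorem admissiblePair_one : AdmissiblePair 1 = fun h => 5 ≤ h ∨ h = 3 := by
  ext h
  simp only [AdmissiblePair, Nat.ModEq]
  omega

theorem admissiblePair_two : AdmissiblePair 2 = fun h => 5 ≤ h := by
  ext h
  simp only [AdmissiblePair, Nat.ModEq]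
  omega

theorem admissiblePair_three : AdmissiblePair 3 = fun h => 7 ≤ h := by
  ext h
  simp only [AdmissiblePair, Nat.ModEq]
  omega

/-! ### The recurrence -/

/-- The system of recurrences satisfied by the series (in `q`) of admissible partitions into `m`
parts with smallest part at least `1` (for `F`), `2` (for `H`) and `3` (for `K`). -/
structure CapparelliSystem (F H K : ℕ → MvPowerSeries (Fin 2) ℤ) : Prop where
  F_zero : F 0 = 1
  H_zero : H 0 = 1
  F_one : F 1 = H 1 + qVar * H 0
  F_add_two : ∀ m, F (m + 2) =
    H (m + 2) + qVar * (qVar ^ (3 * (m + 1)) * H (m + 1) + qVar ^ 3 * (qVar ^ (6 * m) * F m))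
  H_succ : ∀ m, H (m + 1) = K (m + 1) + qVar ^ 2 * (qVar ^ (3 * m) * H m)
  K_succ : ∀ m, K (m + 1) =
    qVar ^ (3 * (m + 1)) * F (m + 1) + qVar ^ 3 * (qVar ^ (6 * m) * F m)

theorem one_sub_qVar_pow_ne_zero (m : ℕ) : (1 : MvPowerSeries (Fin 2) ℤ) - qVar ^ (m + 1) ≠ 0 := by
  intro h
  have := congrArg MvPowerSeries.constantCoeff h
  simp [qVar] at this

/-- Earlier terms fix `F (m + 1) - H (m + 1)`, while `H_succ` and `K_succ` fix `H (m + 1) - qVar ^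
(3 * (m + 1)) * F (m + 1)`. Adding the two determines `F (m + 1)` up to the nonzero factor `1 - qVar
^ (3 * (m + 1))`, cancellable in a domain. -/
theorem CapparelliSystem.unique {F H K F' H' K' : ℕ → MvPowerSeries (Fin 2) ℤ}
    (S : CapparelliSystem F H K) (S' : CapparelliSystem F' H' K') : F = F' := by
  have step : ∀ m, F m = F' m → H m = H' m →
      F (m + 1) - H (m + 1) = F' (m + 1) - H' (m + 1) →
      F (m + 1) = F' (m + 1) ∧ H (m + 1) = H' (m + 1) := by
    intro m hF hH hd
    have h1 := S.H_succ m
    have h2 := S'.H_succ m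
    rw [S.K_succ, hF, hH] at h1
    rw [S'.K_succ] at h2
    have hmul : (1 - qVar ^ (3 * m + 2 + 1)) * (F (m + 1) - F' (m + 1)) = 0 := by
      linear_combination hd + h1 - h2
    have hF1 : F (m + 1) = F' (m + 1) :=
      sub_eq_zero.1 ((mul_eq_zero.1 hmul).resolve_left (one_sub_qVar_pow_ne_zero _))
    exact ⟨hF1, by linear_combination hF1 - hd⟩
  have main : ∀ m, (F m = F' m ∧ H m = H' m) ∧ F (m + 1) = F' (m + 1) ∧ H (m + 1) = H' (m + 1) := by
    intro m
    induction m with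
    | zero =>
      have hF : F 0 = F' 0 := by rw [S.F_zero, S'.F_zero]
      have hH : H 0 = H' 0 := by rw [S.H_zero, S'.H_zero]
      exact ⟨⟨hF, hH⟩, step 0 hF hH (by rw [zero_add, S.F_one, S'.F_one, hH]; ring)⟩
    | succ m ih =>
      obtain ⟨⟨hF, -⟩, hF1, hH1⟩ := ih
      exact ⟨⟨hF1, hH1⟩, step (m + 1) hF1 hH1 (by rw [S.F_add_two, S'.F_add_two, hF, hH1]; ring)⟩
  exact funext fun m => (main m).1.1

theorem capparelliSystem_chainSeries :
    CapparelliSystem (chainSeries fun h => 1 ≤ h) (chainSeries fun h => 2 ≤ h)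
      (chainSeries fun h => 3 ≤ h) where
  F_zero := chainSeries_zero _
  H_zero := chainSeries_zero _
  F_one := by rw [chainSeries_le, chainSeries_zero, chainSeries_zero, pow_one]
  F_add_two m := by
    rw [chainSeries_le, admissiblePair_one, chainSeries_or (fun h h1 h2 => by omega),
      chainSeries_eq, admissiblePair_three, chainSeries_add_three_le 2,
      -- The bound 7 = 1 + 3 + 3 takes two shifts.
      chainSeries_add_three_le 4, chainSeries_add_three_le 1]
    ring
  H_succ m := by
    rw [chainSeries_le, admissiblePair_two, chainSeries_add_three_le 2]
  K_succ m := by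
    rw [chainSeries_le, admissiblePair_three, chainSeries_add_three_le 4,
      chainSeries_add_three_le 1, chainSeries_add_three_le 1]
    ring

/-! ### The double sum -/

theorem qPoch_succ {R : Type*} [CommRing R] (a q : R) (n : ℕ) :
    qPoch a q (n + 1) = qPoch a q n * (1 - a * q ^ n) :=
  Finset.prod_range_succ _ _

theorem eq_qDenomInv_of_qDenom_mul_eq_one {n₁ n₂ : ℕ} {φ : MvPowerSeries (Fin 2) ℤ}
    (h : qDenom n₁ n₂ * φ = 1) : φ = qDenomInv n₁ n₂ :=
  (left_inv_eq_right_inv ((mul_comm _ _).trans (qDenom_mul_qDenomInv n₁ n₂)) h).symm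

theorem one_sub_mul_qDenomInv_succ_left (n₁ n₂ : ℕ) :
    (1 - qVar ^ (n₁ + 1)) * qDenomInv (n₁ + 1) n₂ = qDenomInv n₁ n₂ := by
  apply eq_qDenomInv_of_qDenom_mul_eq_one
  refine Eq.trans ?_ (qDenom_mul_qDenomInv (n₁ + 1) n₂)
  simp only [qDenom, qPoch_succ]
  ring

theorem one_sub_mul_qDenomInv_succ_right (n₁ n₂ : ℕ) :
    (1 - qVar ^ (3 * (n₂ + 1))) * qDenomInv n₁ (n₂ + 1) = qDenomInv n₁ n₂ := by
  apply eq_qDenomInv_of_qDenom_mul_eq_one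
  refine Eq.trans ?_ (qDenom_mul_qDenomInv n₁ (n₂ + 1))
  simp only [qDenom, qPoch_succ]
  ring

theorem qExponent_succ_left (n₁ n₂ : ℕ) :
    qExponent (n₁ + 1) n₂ = qExponent n₁ n₂ + 4 * n₁ + 6 * n₂ + 1 := by
  zify
  rw [qExponent_cast, qExponent_cast]
  push_cast
  ring

theorem qExponent_succ_right (n₁ n₂ : ℕ) :
    qExponent n₁ (n₂ + 1) = qExponent n₁ n₂ + 6 * n₁ + 12 * n₂ + 4 := by
  zify
  rw [qExponent_cast, qExponent_cast]
  push_cast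
  ring

/-- The pairs `(n₁, n₂)` with `n₁ + 2 n₂ = m`. -/
def weightedPairs (m : ℕ) : Finset (ℕ × ℕ) :=
  (Finset.range (m + 1) ×ˢ Finset.range (m + 1)).filter fun p => 2 * p.2 + p.1 = m

theorem mem_weightedPairs {m : ℕ} {p : ℕ × ℕ} : p ∈ weightedPairs m ↔ 2 * p.2 + p.1 = m := by
  simp only [weightedPairs, Finset.mem_filter, Finset.mem_product, Finset.mem_range]
  omega

/-- The coefficient of `x ^ m` in the double sum, its exponents increased by `a n₁ + b n₂`. -/
noncomputable def doubleSum (a b m : ℕ) : MvPowerSeries (Fin 2) ℤ :=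
  ∑ p ∈ weightedPairs m, qVar ^ (qExponent p.1 p.2 + a * p.1 + b * p.2) * qDenomInv p.1 p.2

theorem doubleSum_zero (a b : ℕ) : doubleSum a b 0 = 1 := by
  have h : weightedPairs 0 = {(0, 0)} := by
    ext ⟨n₁, n₂⟩
    simp only [mem_weightedPairs, Finset.mem_singleton, Prod.mk.injEq]
    omega
  have h0 : qDenomInv 0 0 = 1 := by
    simpa [qDenom, qPoch] using qDenom_mul_qDenomInv 0 0
  simp [doubleSum, h, h0, qExponent]

/-- On the index set `c * n₁ + 2 * c * n₂` is the constant `c * m`. -/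
theorem doubleSum_shift (a b c m : ℕ) :
    doubleSum (a + c) (b + 2 * c) m = qVar ^ (c * m) * doubleSum a b m := by
  rw [doubleSum, doubleSum, Finset.mul_sum]
  refine Finset.sum_congr rfl fun p hp => ?_
  rw [← mul_assoc, ← pow_add, ← mem_weightedPairs.1 hp]
  congr 2
  ring

/-- In the difference of the two sums each term gains a factor `1 - qVar ^ n₁`, which kills `n₁ = 0`
and otherwise cancels the last factor of the first Pochhammer symbol; then `n₁` is reindexed. -/
theorem doubleSum_succ_left (a b m : ℕ) :
    doubleSum a b (m + 1) =
      doubleSum (a + 1) b (m + 1) + qVar ^ (a + 1) * doubleSum (a + 4) (b + 6) m := by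
  rw [← sub_eq_iff_eq_add']
  simp only [doubleSum, Finset.mul_sum]
  rw [← Finset.sum_sub_distrib]
  symm
  refine Finset.sum_of_injOn (fun p => (p.1 + 1, p.2)) ?_ ?_ ?_ ?_
  · rintro ⟨a, b⟩ _ ⟨c, d⟩ _ h
    simpa using h
  · intro p hp
    simp only [Finset.mem_coe, mem_weightedPairs] at hp ⊢
    omega
  · rintro ⟨_ | n₁, n₂⟩ hp hn
    · simp
    · refine absurd ⟨(n₁, n₂), ?_, rfl⟩ hn
      simp only [Finset.mem_coe, mem_weightedPairs] at hp ⊢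
      omega
  · rintro ⟨n₁, n₂⟩ -
    rw [← one_sub_mul_qDenomInv_succ_left, qExponent_succ_left]
    ring

theorem doubleSum_succ_right (a b m : ℕ) :
    doubleSum a b (m + 2) =
      doubleSum a (b + 3) (m + 2) + qVar ^ (b + 4) * doubleSum (a + 6) (b + 12) m := by
  rw [← sub_eq_iff_eq_add']
  simp only [doubleSum, Finset.mul_sum]
  rw [← Finset.sum_sub_distrib]
  symm
  refine Finset.sum_of_injOn (fun p => (p.1, p.2 + 1)) ?_ ?_ ?_ ?_
  · rintro ⟨a, b⟩ _ ⟨c, d⟩ _ h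
    simpa using h
  · intro p hp
    simp only [Finset.mem_coe, mem_weightedPairs] at hp ⊢
    omega
  · rintro ⟨n₁, _ | n₂⟩ hp hn
    · simp
    · refine absurd ⟨(n₁, n₂), ?_, rfl⟩ hn
      simp only [Finset.mem_coe, mem_weightedPairs] at hp ⊢
      omega
  · rintro ⟨n₁, n₂⟩ -
    rw [← one_sub_mul_qDenomInv_succ_right, qExponent_succ_right]
    ring

theorem doubleSum_one (a b b' : ℕ) : doubleSum a b 1 = doubleSum a b' 1 := by
  refine Finset.sum_congr rfl fun p hp => ?_
  have : p.2 = 0 := by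
    have := mem_weightedPairs.1 hp
    omega
  simp [this]

theorem capparelliSystem_doubleSum :
    CapparelliSystem (doubleSum 0 0) (doubleSum 1 3) (doubleSum 2 6) where
  F_zero := doubleSum_zero _ _
  H_zero := doubleSum_zero _ _
  F_one := by
    rw [doubleSum_succ_left 0 0 0, doubleSum_zero, doubleSum_zero, doubleSum_one _ 0 3]
    ring
  F_add_two m := by
    have h1 := doubleSum_succ_left 0 0 (m + 1)
    have h2 := doubleSum_succ_right 1 0 m
    have h3 := doubleSum_shift 0 0 6 m
    have h4 := doubleSum_shift 1 3 3 (m + 1)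
    rw [← h3, ← h4]
    -- For `m + 1 = 1` no pair has `n₂ > 0`, so the second shift is irrelevant. Otherwise `h5` and
    -- `h6` both bring in `doubleSum 10 18 k`, which cancels.
    cases m with
    | zero =>
      have h5 := doubleSum_one 4 6 9
      simp only [doubleSum_zero, zero_add, Nat.reduceMul, Nat.reduceAdd] at *
      linear_combination h1 + h2 + qVar * h5
    | succ k =>
      have h5 := doubleSum_succ_right 4 6 k
      have h6 := doubleSum_succ_left 6 12 k
      simp only [zero_add, Nat.reduceMul, Nat.reduceAdd, add_assoc] at *
      linear_combination h1 + h2 + qVar * h5 - qVar ^ 4 * h6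
  H_succ m := by
    have h1 := doubleSum_succ_left 1 3 m
    have h4 := doubleSum_shift 1 3 3 m
    rw [← h4]
    -- The same case split; here the cancelling term is `doubleSum 8 15 k`.
    cases m with
    | zero =>
      have h5 := doubleSum_one 2 3 6
      simp only [doubleSum_zero, zero_add, Nat.reduceMul, Nat.reduceAdd] at *
      linear_combination h1 + h5
    | succ k =>
      have h5 := doubleSum_succ_right 2 3 k
      have h6 := doubleSum_succ_left 4 9 k
      simp only [Nat.reduceMul, Nat.reduceAdd, add_assoc] at *
      linear_combination h1 + h5 - qVar ^ 2 * h6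
  K_succ m := by
    have h1 := doubleSum_succ_left 2 6 m
    have h2 := doubleSum_shift 0 0 3 (m + 1)
    have h3 := doubleSum_shift 0 0 6 m
    rw [← h2, ← h3]
    exact h1

theorem chainSeries_one_le_eq_doubleSum (m : ℕ) :
    chainSeries (fun h => 1 ≤ h) m = doubleSum 0 0 m :=
  congrFun (capparelliSystem_chainSeries.unique capparelliSystem_doubleSum) m

/-! ### Summation -/

theorem coeff_natCast_mul_qVar_pow_mul_xVar_pow (c n m : ℕ) (d : Fin 2 →₀ ℕ) :
    MvPowerSeries.coeff d ((c : MvPowerSeries (Fin 2) ℤ) * qVar ^ n * xVar ^ m) =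
      if (n, m) = (d 0, d 1) then (c : ℤ) else 0 := by
  have h : (c : MvPowerSeries (Fin 2) ℤ) = MvPowerSeries.C (c : ℤ) := by simp
  rw [h, mul_assoc, MvPowerSeries.coeff_C_mul, coeff_mul_xVar_pow, qVar, MvPowerSeries.coeff_X_pow]
  have h' : (d - Finsupp.single 1 m = Finsupp.single 0 n ∧ m ≤ d 1) ↔ (n, m) = (d 0, d 1) := by
    rw [Finsupp.ext_iff, Fin.forall_fin_two]
    simp
    omega
  simp only [← h', ite_and]
  split_ifs <;> simp

/-- The generating function of `cpOneOne`. -/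
noncomputable def cpSeries : MvPowerSeries (Fin 2) ℤ :=
  fun d => (cpOneOne (d 0) (d 1) : ℤ)

theorem coeff_cpSeries (d : Fin 2 →₀ ℕ) :
    MvPowerSeries.coeff d cpSeries = (cpOneOne (d 0) (d 1) : ℤ) := rfl

theorem hasSum_cpOneOne :
    HasSum (fun k : ℕ × ℕ => (cpOneOne k.1 k.2 : MvPowerSeries (Fin 2) ℤ) * qVar ^ k.1 * xVar ^ k.2)
      cpSeries := by
  rw [MvPowerSeries.WithPiTopology.hasSum_iff_hasSum_coeff]
  intro d
  rw [coeff_cpSeries]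
  have h := hasSum_single (f := fun k : ℕ × ℕ => MvPowerSeries.coeff d
    ((cpOneOne k.1 k.2 : MvPowerSeries (Fin 2) ℤ) * qVar ^ k.1 * xVar ^ k.2)) (d 0, d 1) ?_
  · rwa [coeff_natCast_mul_qVar_pow_mul_xVar_pow, if_pos rfl] at h
  · intro k hk
    rw [coeff_natCast_mul_qVar_pow_mul_xVar_pow, if_neg hk]


/-- Equality with `chainSeries` shows that `doubleSum 0 0 m` is free of `x`, so only `m = d 1`
contributes. -/
theorem coeff_doubleSum_mul_xVar_pow (m : ℕ) (d : Fin 2 →₀ ℕ) :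
    MvPowerSeries.coeff d (doubleSum 0 0 m * xVar ^ m) =
      if m = d 1 then (cpOneOne (d 0) (d 1) : ℤ) else 0 := by
  rw [← chainSeries_one_le_eq_doubleSum, coeff_mul_xVar_pow, chainSeries, coeff_qSeries]
  have h1 : (d - Finsupp.single 1 m : Fin 2 →₀ ℕ) 1 = d 1 - m := by simp
  have h0 : (d - Finsupp.single 1 m : Fin 2 →₀ ℕ) 0 = d 0 := by simp
  rw [h1, h0, ← cpOneOne_eq_ncard]
  by_cases hm : m = d 1
  · simp [hm]
  · rw [if_neg hm]
    split_ifs <;> first | rfl | omega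

theorem hasSum_doubleSum :
    HasSum (fun k : ℕ × ℕ => qVar ^ qExponent k.1 k.2 * xVar ^ (2 * k.2 + k.1) * qDenomInv k.1 k.2)
      cpSeries := by
  rw [MvPowerSeries.WithPiTopology.hasSum_iff_hasSum_coeff]
  intro d
  rw [coeff_cpSeries]
  -- Terms with `2 * n₂ + n₁ > d 1` have coefficient 0 at `d`, so the sum is finite and can be
  -- grouped by the power of `x`.
  have h := hasSum_sum_of_ne_finset_zero (L := .unconditional _)
    (f := fun k : ℕ × ℕ => MvPowerSeries.coeff d
      (qVar ^ qExponent k.1 k.2 * xVar ^ (2 * k.2 + k.1) * qDenomInv k.1 k.2))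
    (s := (Finset.range (d 1 + 1)).biUnion weightedPairs) ?_
  · rw [Finset.sum_biUnion] at h
    · have hsum : ∀ m ∈ Finset.range (d 1 + 1), ∑ k ∈ weightedPairs m, MvPowerSeries.coeff d
          (qVar ^ qExponent k.1 k.2 * xVar ^ (2 * k.2 + k.1) * qDenomInv k.1 k.2) =
          if m = d 1 then (cpOneOne (d 0) (d 1) : ℤ) else 0 := by
        intro m _
        rw [← coeff_doubleSum_mul_xVar_pow, doubleSum, Finset.sum_mul, map_sum]
        refine Finset.sum_congr rfl fun k hk => ?_
        rw [mem_weightedPairs.1 hk, zero_mul, zero_mul, add_zero, add_zero, mul_right_comm]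
      rwa [Finset.sum_congr rfl hsum, Finset.sum_ite_eq',
        if_pos (Finset.self_mem_range_succ _)] at h
    · intro m _ m' _ hmm
      refine Finset.disjoint_left.2 fun k hk hk' => hmm ?_
      rw [← mem_weightedPairs.1 hk, ← mem_weightedPairs.1 hk']
  · intro k hk
    rw [mul_right_comm, coeff_mul_xVar_pow, if_neg]
    intro hle
    exact hk (Finset.mem_biUnion.2
      ⟨_, Finset.mem_range.2 (Nat.lt_succ_of_le hle), mem_weightedPairs.2 rfl⟩)

theorem mainTheorem6 :
    Summable (fun k : ℕ × ℕ =>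
      (cpOneOne k.1 k.2 : MvPowerSeries (Fin 2) ℤ) * qVar ^ k.1 * xVar ^ k.2) ∧
    Summable (fun k : ℕ × ℕ =>
      qVar ^ qExponent k.1 k.2 * xVar ^ (2 * k.2 + k.1) * qDenomInv k.1 k.2) ∧
    ∑' k : ℕ × ℕ,
        (cpOneOne k.1 k.2 : MvPowerSeries (Fin 2) ℤ) * qVar ^ k.1 * xVar ^ k.2 =
      ∑' k : ℕ × ℕ,
        qVar ^ qExponent k.1 k.2 * xVar ^ (2 * k.2 + k.1) * qDenomInv k.1 k.2 := by
  exact ⟨hasSum_cpOneOne.summable, hasSum_doubleSum.summable,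
    hasSum_cpOneOne.tsum_eq.trans hasSum_doubleSum.tsum_eq.symm⟩
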